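/- For non-negative integers $n,r,s$ let $a_n(r,s)=\sum_{k=0}^n\binom nk^r\binom{n+k}k^s$ be the generalised Apéry numbers; in particular $a_n(2,0)=\binom{2n}n$. Write the $3$-adic expansion of a non-negative integer $n$ with its most significant digit first and without leading zeros (the expansion of $0$ is the empty string). Let $d_1$ and $d_2$ be the numbers of digits $1$ and $2$ in it, and let $m$ be the number of its maximal strings of $1$'s (maximal blocks of consecutive digits $1$). A string $xy$ is contained in the expansion if $x$ and $y$ occur in it as consecutive digits in this order; a digit $2$ at the beginning of the expansion also counts as an occurrence of the string $02$. Let $r$ be a positive integer with $r\equiv 2\pmod 6$. Then for every non-negative integer $n$: - (i) $a_n(r,0)\equiv1\pmod 9$ if and only if $d_2=0$, $d_1$ is even, and $m\equiv0\pmod 3$; - (ii) $a_n(r,0)\equiv2\pmod 9$ if and only if $d_2=0$, $d_1$ is odd, and $m\equiv1\pmod 3$; - (iii) $a_n(r,0)\equiv3\pmod 9$ if and only if the expansion of $n$ contains the string $02$ and no other digit $2$ (that is, $d_2=1$), and $d_1$ is odd; - (iv) $a_n(r,0)\equiv4\pmod 9$ if and only if $d_2=0$, $d_1$ is even, and $m\equiv2\pmod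 3$; - (v) $a_n(r,0)\equiv5\pmod 9$ if and only if $d_2=0$, $d_1$ is odd, and $m\equiv2\pmod 3$; - (vi) $a_n(r,0)\equiv6\pmod 9$ if and only if the expansion of $n$ contains the string $02$ and no other digit $2$ (that is, $d_2=1$), and $d_1$ is even; - (vii) $a_n(r,0)\equiv7\pmod 9$ if and only if $d_2=0$, $d_1$ is even, and $m\equiv1\pmod 3$; - (viii) $a_n(r,0)\equiv8\pmod 9$ if and only if $d_2=0$, $d_1$ is odd, and $m\equiv0\pmod 3$; - (ix) $a_n(r,0)\equiv0\pmod 9$ if and only if $d_2\ge2$ or the expansion of $n$ contains the string $12$. -/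

import Mathlib

/-- The generalised Apéry number `a_n(r,s) = ∑_{k=0}^n (n choose k)^r (n+k choose k)^s`. -/
def aperyNumber (n r s : ℕ) : ℕ :=
  ∑ k ∈ Finset.range (n + 1), n.choose k ^ r * (n + k).choose k ^ s

/-- The ternary expansion of `n` as a string of digits, most significant digit first and without
leading zeros (the expansion of `0` is the empty string). -/
def ternaryExpansion (n : ℕ) : List ℕ :=
  (Nat.digits 3 n).reverse

/-- The maximal strings of `a`'s in `w`: the pairs `(i, j)` of positions with `i ≤ j` such that all
letters at the positions `i, ..., j` are `a`, and neither the letter before position `i` nor the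
letter after position `j` (if there is one) is `a`. -/
def maximalStrings (a : ℕ) (w : List ℕ) : Finset (ℕ × ℕ) :=
  {p ∈ Finset.range w.length ×ˢ Finset.range w.length |
    p.1 ≤ p.2 ∧ (∀ t ∈ Finset.Icc p.1 p.2, w[t]? = some a) ∧
      (p.1 = 0 ∨ w[p.1 - 1]? ≠ some a) ∧ w[p.2 + 1]? ≠ some a}

/-- The number of occurrences of the digit `d` in the ternary expansion of `n`. -/
def digitCount (d n : ℕ) : ℕ :=
  (ternaryExpansion n).count d

/-- The number of maximal strings of `1`'s in the ternary expansion of `n`. -/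
def oneStringCount (n : ℕ) : ℕ :=
  (maximalStrings 1 (ternaryExpansion n)).card

/-- The ternary expansion of `n` contains the string `12` (as consecutive digits). -/
def ContainsOneTwo (n : ℕ) : Prop :=
  [1, 2] <:+: ternaryExpansion n

/-- The ternary expansion of `n` contains the string `02` (as consecutive digits), where a `2` at
the beginning of the expansion also counts as an occurrence of `02`. -/
def ContainsZeroTwo (n : ℕ) : Prop :=
  [0, 2] <:+: 0 :: ternaryExpansion n

/-!
For `r ≡ 2 (mod 6)` every residue `x` modulo `9` satisfies `x ^ r = x ^ 2`, so `a_n(r,0)` is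
congruent to `a_n(2,0)`, the central binomial coefficient `c(n)`. Babbage's congruence
`(p a choose p b) ≡ (a choose b) (mod p²)` gives `c(3n) ≡ c(n) (mod 9)`, and the recurrence
`(n + 1) c(n + 1) = 2 (2n + 1) c(n)` then expresses `c(3n + 1)` and `c(3n + 2)` by `c(n)`: appending
the digit `0` changes nothing, appending `1` multiplies by `-1` after a `1` and by `-7` otherwise,
and appending `2` multiplies by `0` after a `1` and by `6` otherwise. Hence `c(n) ≡ 0` if the string
`12` occurs, and `c(n) ≡ (-1)^d₁ 7^m 6^d₂` if not. The classification can be read off from this,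
because `-1` and `7` have orders `2` and `3` modulo `9` while `6 · 7 ≡ 6` and `6² ≡ 0`.
-/

theorem pow_eq_pow_of_modEq_of_le {M : Type*} [Monoid M] {x : M} {a t r : ℕ}
    (hx : x ^ (a + t) = x ^ a) (har : a ≤ r) (hr : r ≡ a [MOD t]) : x ^ r = x ^ a := by
  obtain ⟨k, hk⟩ := (Nat.modEq_iff_dvd' har).mp hr.symm
  obtain rfl : r = a + t * k := by omega
  clear hk har hr
  induction k with
  | zero => rfl
  | succ k ih => rw [mul_add_one, ← add_assoc, add_right_comm, pow_add, hx, ← pow_add, ih]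

theorem aperyNumber_two_zero (n : ℕ) : aperyNumber n 2 0 = (2 * n).choose n := by
  simp [aperyNumber, Nat.sum_range_choose_sq]

theorem cast_aperyNumber_zmod_nine {r : ℕ} (hr : r ≡ 2 [MOD 6]) (n : ℕ) :
    (aperyNumber n r 0 : ZMod 9) = n.centralBinom := by
  have hsq (x : ZMod 9) : x ^ r = x ^ 2 :=
    pow_eq_pow_of_modEq_of_le (by revert x; decide) (by have : r % 6 = 2 := hr; omega) hr
  rw [Nat.centralBinom_eq_two_mul_choose, ← aperyNumber_two_zero]
  simp only [aperyNumber, Nat.cast_sum, Nat.cast_mul, Nat.cast_pow, pow_zero, hsq]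

section Babbage

variable {p : ℕ}

theorem prime_dvd_choose_mul_of_not_dvd (hp : p.Prime) (a : ℕ) {i : ℕ} (hi : ¬ p ∣ i) :
    p ∣ (p * a).choose i := by
  obtain ⟨j, rfl⟩ := Nat.exists_eq_succ_of_ne_zero (n := i) (by rintro rfl; simp at hi)
  rcases Nat.eq_zero_or_pos (p * a) with h0 | hpos
  · simp [h0]
  · have habsorb := Nat.add_one_mul_choose_eq (p * a - 1) j
    rw [Nat.sub_add_cancel hpos] at habsorb
    have hdvd : p ∣ (p * a).choose (j + 1) * (j + 1) :=
      habsorb ▸ (dvd_mul_right p a).mul_right _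
    exact (hp.dvd_mul.mp hdvd).resolve_right hi

theorem prime_sq_dvd_choose_mul_mul_choose (hp : p.Prime) (a : ℕ) {i j : ℕ} (hij : p ∣ i + j)
    (hj0 : j ≠ 0) (hjp : j ≠ p) : p ^ 2 ∣ (p * a).choose i * p.choose j := by
  rcases lt_or_gt_of_ne hjp with hlt | hgt
  · have hj : ¬ p ∣ j := Nat.not_dvd_of_pos_of_lt (Nat.pos_of_ne_zero hj0) hlt
    have hi : ¬ p ∣ i := fun hi => hj ((Nat.dvd_add_right hi).mp hij)
    rw [sq]
    exact mul_dvd_mul (prime_dvd_choose_mul_of_not_dvd hp a hi) (hp.dvd_choose_self hj0 hlt)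
  · simp [Nat.choose_eq_zero_of_lt hgt]

theorem choose_prime_mul_prime_mul_modEq (hp : p.Prime) (a b : ℕ) :
    (p * a).choose (p * b) ≡ a.choose b [MOD p ^ 2] := by
  rw [← ZMod.natCast_eq_natCast_iff]
  induction a generalizing b with
  | zero =>
    cases b with
    | zero => simp
    | succ b => simp [Nat.choose_eq_zero_of_lt (Nat.mul_pos hp.pos b.succ_pos)]
  | succ a ih =>
    cases b with
    | zero => simp
    | succ b =>
      -- Only the terms `j = 0` and `j = p` of Vandermonde's identity for `p * a + p` survive: in
      -- the others both factors are multiples of `p`.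
      have hvanish : ∀ ij ∈ Finset.HasAntidiagonal.antidiagonal (p * (b + 1)),
          ij ≠ (p * (b + 1), 0) ∧ ij ≠ (p * b, p) →
          (((p * a).choose ij.1 * p.choose ij.2 : ℕ) : ZMod (p ^ 2)) = 0 := by
        rintro ⟨i, j⟩ hij ⟨hj0, hjp⟩
        rw [Finset.HasAntidiagonal.mem_antidiagonal] at hij
        refine (ZMod.natCast_eq_zero_iff _ _).mpr
          (prime_sq_dvd_choose_mul_mul_choose hp a (Dvd.intro _ hij.symm) ?_ ?_)
        · rintro rfl
          exact hj0 (by simpa using hij)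
        · rintro rfl
          exact hjp (by simpa [mul_add_one] using hij)
      rw [mul_add_one, Nat.add_choose_eq, Nat.cast_sum,
        Finset.sum_eq_add (p * (b + 1), 0) (p * b, p) (by simp [hp.ne_zero.symm]) hvanish
          (by simp) (by simp [mul_add_one])]
      simp [ih, Nat.choose_succ_succ, add_comm]

end Babbage

theorem three_mul_cast_zmod_nine (n : ℕ) : (3 * n : ZMod 9) = 3 * (n % 3 : ℕ) := by
  have h := (Nat.mod_modEq n 3).symm.mul_left' 3
  exact_mod_cast (ZMod.natCast_eq_natCast_iff _ _ 9).mpr h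

theorem cast_centralBinom_three_mul (n : ℕ) :
    ((3 * n).centralBinom : ZMod 9) = n.centralBinom := by
  rw [Nat.centralBinom_eq_two_mul_choose, Nat.centralBinom_eq_two_mul_choose, mul_left_comm]
  exact (ZMod.natCast_eq_natCast_iff _ _ 9).mpr
    (choose_prime_mul_prime_mul_modEq Nat.prime_three (2 * n) n)

theorem cast_centralBinom_three_mul_add_one (n : ℕ) :
    ((3 * n + 1).centralBinom : ZMod 9) = 2 * (1 + 3 * n) * n.centralBinom := by
  have h := congrArg (Nat.cast : ℕ → ZMod 9) (Nat.succ_mul_centralBinom_succ (3 * n))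
  push_cast [cast_centralBinom_three_mul] at h
  have h9 : (9 : ZMod 9) = 0 := rfl
  -- `1 - 3 * n` is the inverse of `3 * n + 1`.
  linear_combination (1 - 3 * (n : ZMod 9)) * h +
    (n : ZMod 9) ^ 2 * ((3 * n + 1).centralBinom - 4 * n.centralBinom) * h9

theorem cast_centralBinom_three_mul_add_two (n : ℕ) :
    ((3 * n + 2).centralBinom : ZMod 9) = 6 * (2 * n + 1) * n.centralBinom := by
  have h := congrArg (Nat.cast : ℕ → ZMod 9) (Nat.succ_mul_centralBinom_succ (3 * n + 1))
  push_cast [cast_centralBinom_three_mul_add_one] at h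
  have h9 : (9 : ZMod 9) = 0 := rfl
  -- `6 * n + 5` is the inverse of `3 * n + 2`.
  linear_combination (6 * (n : ZMod 9) + 5) * h +
    ((2 * (n : ZMod 9) + 1) * (6 + 28 * n + 24 * n ^ 2) * n.centralBinom -
      (1 + 3 * n + 2 * n ^ 2) * (3 * n + 2).centralBinom) * h9

theorem three_mul_cast_centralBinom_of_mod_three {n : ℕ} (h : n % 3 = 2) :
    (3 : ZMod 9) * n.centralBinom = 0 := by
  have hn : 3 * (n / 3) + 2 = n := by omega
  have h9 : (9 : ZMod 9) = 0 := rfl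
  have hc := cast_centralBinom_three_mul_add_two (n / 3)
  rw [hn] at hc
  rw [hc]
  linear_combination 2 * (2 * ((n / 3 : ℕ) : ZMod 9) + 1) * (n / 3).centralBinom * h9

theorem cast_centralBinom_three_mul_add_one_eq_ite (n : ℕ) :
    ((3 * n + 1).centralBinom : ZMod 9) =
      (if n % 3 = 1 then -1 else -7) * n.centralBinom := by
  have h9 : (9 : ZMod 9) = 0 := rfl
  rw [cast_centralBinom_three_mul_add_one, three_mul_cast_zmod_nine]
  obtain h | h | h : n % 3 = 0 ∨ n % 3 = 1 ∨ n % 3 = 2 := by omega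
  · rw [h, if_neg (by decide), Nat.cast_zero]
    linear_combination (n.centralBinom : ZMod 9) * h9
  · rw [h, if_pos rfl, Nat.cast_one]
    linear_combination (n.centralBinom : ZMod 9) * h9
  · rw [h, if_neg (by decide), Nat.cast_two]
    linear_combination 7 * three_mul_cast_centralBinom_of_mod_three h

theorem cast_centralBinom_three_mul_add_two_eq_ite (n : ℕ) :
    ((3 * n + 2).centralBinom : ZMod 9) = (if n % 3 = 1 then 0 else 6) * n.centralBinom := by
  have h9 : (9 : ZMod 9) = 0 := rfl
  have hfactor : (6 * (2 * n + 1) : ZMod 9) = 4 * (3 * (n % 3 : ℕ)) + 6 := by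
    rw [← three_mul_cast_zmod_nine]; ring
  rw [cast_centralBinom_three_mul_add_two, hfactor]
  obtain h | h | h : n % 3 = 0 ∨ n % 3 = 1 ∨ n % 3 = 2 := by omega
  · rw [h, if_neg (by decide), Nat.cast_zero]
    ring
  · rw [h, if_pos rfl, Nat.cast_one]
    linear_combination 2 * (n.centralBinom : ZMod 9) * h9
  · rw [h, if_neg (by decide), Nat.cast_two]
    linear_combination 8 * three_mul_cast_centralBinom_of_mod_three h

section Strings

variable {α : Type*}

theorem pair_infix_concat_iff {a b d : α} {w : List α} :
    [a, b] <:+: w ++ [d] ↔ [a, b] <:+: w ∨ (d = b ∧ w.getLast? = some a) := by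
  have hsuffix : [a, b] <:+ w ++ [d] ↔ d = b ∧ w.getLast? = some a := by
    rw [← List.reverse_prefix, List.reverse_concat, List.getLast?_eq_head?_reverse]
    cases w.reverse <;> simp [eq_comm]
  rw [List.infix_concat_iff, hsuffix, or_comm]

theorem exists_end_of_string {a : α} {w : List α} {i : ℕ} (hi : w[i]? = some a) :
    ∃ j, i ≤ j ∧ j < w.length ∧ (∀ t ∈ Finset.Icc i j, w[t]? = some a) ∧
      w[j + 1]? ≠ some a := by
  classical
  have hilt : i < w.length := (List.getElem?_eq_some_iff.mp hi).1
  have hex : ∃ j, i ≤ j ∧ w[j + 1]? ≠ some a := ⟨w.length, hilt.le, by simp⟩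
  obtain ⟨hle, hend⟩ := Nat.find_spec hex
  have hrun : ∀ t ∈ Finset.Icc i (Nat.find hex), w[t]? = some a := by
    intro t ht
    obtain ⟨hit, htj⟩ := Finset.mem_Icc.mp ht
    rcases hit.eq_or_lt with rfl | hlt
    · exact hi
    · have hmin := Nat.find_min hex (m := t - 1) (by omega)
      rw [Nat.sub_add_cancel (by omega)] at hmin
      exact not_not.mp fun hne => hmin ⟨by omega, hne⟩
  have hlast := hrun _ (Finset.right_mem_Icc.mpr hle)
  exact ⟨Nat.find hex, hle, (List.getElem?_eq_some_iff.mp hlast).1, hrun, hend⟩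

variable [DecidableEq α]

/-- The positions at which a maximal string of `a`'s begins in `w`. A maximal string is determined
by its first position, so these positions count the maximal strings. -/
def stringStarts (a : α) (w : List α) : Finset ℕ :=
  {i ∈ Finset.range w.length | w[i]? = some a ∧ (i = 0 ∨ w[i - 1]? ≠ some a)}

theorem injOn_fst_maximalStrings (a : ℕ) (w : List ℕ) :
    Set.InjOn Prod.fst (maximalStrings a w : Set (ℕ × ℕ)) := by
  rintro ⟨i, j⟩ hp ⟨i', j'⟩ hp' (rfl : i = i')
  simp only [maximalStrings, Finset.coe_filter, Set.mem_ofPred_eq, Finset.mem_Icc] at hp hp'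
  obtain ⟨-, hij, hrun, -, hend⟩ := hp
  obtain ⟨-, hij', hrun', -, hend'⟩ := hp'
  rcases lt_trichotomy j j' with h | rfl | h
  · exact absurd (hrun' (j + 1) ⟨by omega, h⟩) hend
  · rfl
  · exact absurd (hrun (j' + 1) ⟨by omega, h⟩) hend'

theorem image_fst_maximalStrings (a : ℕ) (w : List ℕ) :
    (maximalStrings a w).image Prod.fst = stringStarts a w := by
  ext i
  simp only [maximalStrings, stringStarts, Finset.mem_image, Finset.mem_filter,
    Finset.mem_product, Finset.mem_range, Prod.exists, exists_and_right, exists_eq_right]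
  constructor
  · rintro ⟨j, ⟨hi, -⟩, hij, hrun, hstart, -⟩
    exact ⟨hi, hrun i (Finset.left_mem_Icc.mpr hij), hstart⟩
  · rintro ⟨hi, hia, hstart⟩
    obtain ⟨j, hij, hj, hrun, hend⟩ := exists_end_of_string hia
    exact ⟨j, ⟨hi, hj⟩, hij, hrun, hstart, hend⟩

theorem card_maximalStrings (a : ℕ) (w : List ℕ) :
    (maximalStrings a w).card = (stringStarts a w).card := by
  rw [← image_fst_maximalStrings, Finset.card_image_of_injOn (injOn_fst_maximalStrings a w)]

theorem card_stringStarts_concat (a d : α) (w : List α) :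
    (stringStarts a (w ++ [d])).card =
      (stringStarts a w).card + if d = a ∧ w.getLast? ≠ some a then 1 else 0 := by
  have hold : ∀ i < w.length, (w ++ [d])[i]? = w[i]? := fun i hi =>
    List.getElem?_append_left hi
  have hfilter : {i ∈ Finset.range w.length | (w ++ [d])[i]? = some a ∧
      (i = 0 ∨ (w ++ [d])[i - 1]? ≠ some a)} = stringStarts a w := by
    refine Finset.filter_congr fun i hi => ?_
    have hi' := Finset.mem_range.mp hi
    rw [hold i hi', hold (i - 1) (by omega)]
  have hnew : ((w ++ [d])[w.length]? = some a ∧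
      (w.length = 0 ∨ (w ++ [d])[w.length - 1]? ≠ some a)) ↔
      (d = a ∧ w.getLast? ≠ some a) := by
    rcases eq_or_ne w [] with rfl | hw
    · simp
    · have hpos : 0 < w.length := List.length_pos_iff.mpr hw
      rw [hold (w.length - 1) (by omega), List.getLast?_eq_getElem?]
      simp [hw]
  rw [stringStarts, List.length_append, List.length_singleton, Finset.range_add_one,
    Finset.filter_insert, hfilter, if_congr hnew rfl rfl]
  split_ifs
  · exact Finset.card_insert_of_notMem (by simp [stringStarts])
  · rfl

end Strings

section TernaryExpansion

theorem ternary_induction {P : ℕ → Prop} (zero : P 0)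
    (append : ∀ n d, d < 3 → (d ≠ 0 ∨ n ≠ 0) → P n → P (3 * n + d)) (n : ℕ) : P n := by
  induction n using Nat.strong_induction_on with
  | _ n ih =>
    rcases eq_or_ne n 0 with rfl | hn
    · exact zero
    · have hP := append (n / 3) (n % 3) (Nat.mod_lt _ (by norm_num)) (by omega) (ih _ (by omega))
      rwa [Nat.div_add_mod] at hP

theorem ternaryExpansion_zero : ternaryExpansion 0 = [] := by simp [ternaryExpansion]

theorem digitCount_zero_right (a : ℕ) : digitCount a 0 = 0 := by
  simp [digitCount, ternaryExpansion_zero]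

theorem oneStringCount_zero : oneStringCount 0 = 0 := by
  simp [oneStringCount, ternaryExpansion_zero, maximalStrings]

theorem not_containsOneTwo_zero : ¬ ContainsOneTwo 0 := by
  simp [ContainsOneTwo, ternaryExpansion_zero]

variable {n d : ℕ}

theorem ternaryExpansion_three_mul_add (hd : d < 3) (h : d ≠ 0 ∨ n ≠ 0) :
    ternaryExpansion (3 * n + d) = ternaryExpansion n ++ [d] := by
  rw [ternaryExpansion, add_comm, Nat.digits_add 3 (by norm_num) d n hd h, List.reverse_cons,
    ternaryExpansion]

theorem getLast?_zero_cons_ternaryExpansion (n : ℕ) :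
    (0 :: ternaryExpansion n).getLast? = some (n % 3) := by
  rcases eq_or_ne n 0 with rfl | hn
  · simp [ternaryExpansion_zero]
  · have hlast := ternaryExpansion_three_mul_add (n := n / 3) (d := n % 3)
      (Nat.mod_lt _ (by norm_num)) (by omega)
    rw [Nat.div_add_mod] at hlast
    simp [hlast, List.getLast?_cons]

theorem getLast?_ternaryExpansion_eq_some_iff {a : ℕ} (ha : a ≠ 0) :
    (ternaryExpansion n).getLast? = some a ↔ n % 3 = a := by
  rw [← Option.some_inj (a := n % 3), ← getLast?_zero_cons_ternaryExpansion, List.getLast?_cons]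
  cases (ternaryExpansion n).getLast? <;> simp [ha.symm]

theorem digitCount_three_mul_add (a : ℕ) (hd : d < 3) (h : d ≠ 0 ∨ n ≠ 0) :
    digitCount a (3 * n + d) = digitCount a n + if d = a then 1 else 0 := by
  simp [digitCount, ternaryExpansion_three_mul_add hd h, List.count_singleton]

theorem oneStringCount_three_mul_add (hd : d < 3) (h : d ≠ 0 ∨ n ≠ 0) :
    oneStringCount (3 * n + d) = oneStringCount n + if d = 1 ∧ n % 3 ≠ 1 then 1 else 0 := by
  simp only [oneStringCount, card_maximalStrings, ternaryExpansion_three_mul_add hd h,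
    card_stringStarts_concat, ne_eq, getLast?_ternaryExpansion_eq_some_iff one_ne_zero]

theorem containsOneTwo_three_mul_add (hd : d < 3) (h : d ≠ 0 ∨ n ≠ 0) :
    ContainsOneTwo (3 * n + d) ↔ ContainsOneTwo n ∨ (d = 2 ∧ n % 3 = 1) := by
  rw [ContainsOneTwo, ternaryExpansion_three_mul_add hd h, pair_infix_concat_iff,
    getLast?_ternaryExpansion_eq_some_iff one_ne_zero, ContainsOneTwo]

theorem containsZeroTwo_three_mul_add (hd : d < 3) (h : d ≠ 0 ∨ n ≠ 0) :
    ContainsZeroTwo (3 * n + d) ↔ ContainsZeroTwo n ∨ (d = 2 ∧ n % 3 = 0) := by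
  rw [ContainsZeroTwo, ternaryExpansion_three_mul_add hd h, ← List.cons_append,
    pair_infix_concat_iff, getLast?_zero_cons_ternaryExpansion, Option.some_inj, ContainsZeroTwo]

theorem ContainsOneTwo.digitCount_two_pos (h : ContainsOneTwo n) : 0 < digitCount 2 n :=
  List.count_pos_iff.mpr (h.subset (by simp))

theorem ContainsZeroTwo.digitCount_two_pos (h : ContainsZeroTwo n) : 0 < digitCount 2 n := by
  have hmem : 2 ∈ 0 :: ternaryExpansion n := h.subset (by simp)
  exact List.count_pos_iff.mpr (by simpa using hmem)

theorem digitCount_two_pos_of_mod_three (h : n % 3 = 2) : 0 < digitCount 2 n :=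
  List.count_pos_iff.mpr <| List.mem_of_getLast? <|
    (getLast?_ternaryExpansion_eq_some_iff two_ne_zero).mpr h

theorem containsZeroTwo_iff_not_containsOneTwo (hn : digitCount 2 n = 1) :
    ContainsZeroTwo n ↔ ¬ ContainsOneTwo n := by
  induction n using ternary_induction with
  | zero => simp [digitCount_zero_right] at hn
  | append n d hd h ih =>
    rw [digitCount_three_mul_add 2 hd h] at hn
    rw [containsZeroTwo_three_mul_add hd h, containsOneTwo_three_mul_add hd h]
    by_cases hd2 : d = 2
    · have hnone : digitCount 2 n = 0 := by simpa [hd2] using hn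
      have h02 : ¬ ContainsZeroTwo n := fun hc => hc.digitCount_two_pos.ne' hnone
      have h12 : ¬ ContainsOneTwo n := fun hc => hc.digitCount_two_pos.ne' hnone
      have hlast : n % 3 ≠ 2 := fun hm => (digitCount_two_pos_of_mod_three hm).ne' hnone
      simp only [h02, h12, hd2, true_and, false_or]
      omega
    · simpa [hd2] using ih (by simpa [hd2] using hn)

end TernaryExpansion

theorem six_mul_seven_pow_zmod_nine (k : ℕ) : (6 : ZMod 9) * 7 ^ k = 6 := by
  induction k with
  | zero => rfl
  | succ k ih => rw [pow_succ, ← mul_assoc, ih]; decide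

theorem six_pow_eq_zero_zmod_nine {k : ℕ} (hk : 2 ≤ k) : (6 : ZMod 9) ^ k = 0 :=
  pow_eq_zero_of_le hk (by decide)

theorem neg_one_pow_mul_seven_pow_inj_zmod_nine {a b a' b' : ℕ} :
    (-1 : ZMod 9) ^ a * 7 ^ b = (-1) ^ a' * 7 ^ b' ↔ a ≡ a' [MOD 2] ∧ b ≡ b' [MOD 3] := by
  have hinj : ∀ i < 2, ∀ j < 3, ∀ i' < 2, ∀ j' < 3,
      ((-1 : ZMod 9) ^ i * 7 ^ j = (-1) ^ i' * 7 ^ j' ↔ i = i' ∧ j = j') := by decide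
  have hseven (k : ℕ) : (7 : ZMod 9) ^ k = 7 ^ (k % 3) := pow_eq_pow_mod k (by decide)
  rw [neg_one_pow_eq_pow_mod_two a, neg_one_pow_eq_pow_mod_two a', hseven b, hseven b']
  exact hinj _ (Nat.mod_lt _ two_pos) _ (Nat.mod_lt _ three_pos)
    _ (Nat.mod_lt _ two_pos) _ (Nat.mod_lt _ three_pos)

theorem six_mul_neg_one_pow_inj_zmod_nine {a a' : ℕ} :
    (6 : ZMod 9) * (-1) ^ a = 6 * (-1) ^ a' ↔ a ≡ a' [MOD 2] := by
  have hinj : ∀ i < 2, ∀ i' < 2, ((6 : ZMod 9) * (-1) ^ i = 6 * (-1) ^ i' ↔ i = i') := by decide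
  rw [neg_one_pow_eq_pow_mod_two a, neg_one_pow_eq_pow_mod_two a']
  exact hinj _ (Nat.mod_lt _ two_pos) _ (Nat.mod_lt _ two_pos)

theorem isUnit_neg_one_pow_mul_seven_pow_zmod_nine (a b : ℕ) :
    IsUnit ((-1 : ZMod 9) ^ a * 7 ^ b) :=
  (isUnit_one.neg.pow a).mul ((IsUnit.of_mul_eq_one 4 (by decide)).pow b)

theorem six_mul_ne_neg_one_pow_mul_seven_pow_zmod_nine (x : ZMod 9) (a b : ℕ) :
    6 * x ≠ (-1) ^ a * 7 ^ b := by
  intro h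
  have hunit : IsUnit (6 * x) := h ▸ isUnit_neg_one_pow_mul_seven_pow_zmod_nine a b
  exact absurd (isUnit_of_mul_isUnit_left hunit) (by decide)

theorem neg_one_pow_mul_seven_pow_ne_zero_zmod_nine (a b : ℕ) : (-1 : ZMod 9) ^ a * 7 ^ b ≠ 0 :=
  have : Nontrivial (ZMod 9) := ZMod.nontrivial_iff.mpr (by decide)
  (isUnit_neg_one_pow_mul_seven_pow_zmod_nine a b).ne_zero

theorem six_mul_neg_one_pow_ne_zero_zmod_nine (a : ℕ) : (6 : ZMod 9) * (-1) ^ a ≠ 0 :=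
  fun h => absurd ((isUnit_one.neg.pow a).mul_left_eq_zero.mp h) (by decide)

theorem cast_centralBinom_of_containsOneTwo {n : ℕ} (hn : ContainsOneTwo n) :
    (n.centralBinom : ZMod 9) = 0 := by
  induction n using ternary_induction with
  | zero => exact (not_containsOneTwo_zero hn).elim
  | append n d hd h ih =>
    rcases (containsOneTwo_three_mul_add hd h).mp hn with h12 | ⟨rfl, hlast⟩
    · interval_cases d <;>
        simp [cast_centralBinom_three_mul, cast_centralBinom_three_mul_add_one,
          cast_centralBinom_three_mul_add_two, ih h12]
    · simp [cast_centralBinom_three_mul_add_two_eq_ite, hlast]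

theorem cast_centralBinom_of_not_containsOneTwo {n : ℕ} (hn : ¬ ContainsOneTwo n) :
    (n.centralBinom : ZMod 9) =
      (-1) ^ digitCount 1 n * 7 ^ oneStringCount n * 6 ^ digitCount 2 n := by
  induction n using ternary_induction with
  | zero => simp [digitCount_zero_right, oneStringCount_zero]
  | append n d hd h ih =>
    rw [containsOneTwo_three_mul_add hd h, not_or] at hn
    obtain ⟨h12, hnew⟩ := hn
    rw [digitCount_three_mul_add 1 hd h, digitCount_three_mul_add 2 hd h,
      oneStringCount_three_mul_add hd h]
    interval_cases d
    · simpa [cast_centralBinom_three_mul] using ih h12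
    · rw [cast_centralBinom_three_mul_add_one_eq_ite, ih h12]
      by_cases hlast : n % 3 = 1
      · simp only [hlast, ↓reduceIte, ne_eq, not_true_eq_false, and_false, add_zero,
          OfNat.one_ne_ofNat]
        ring
      · simp only [hlast, ↓reduceIte, ne_eq, not_false_eq_true, and_self, OfNat.one_ne_ofNat,
          add_zero]
        ring
    · have hlast : n % 3 ≠ 1 := fun hlast => hnew ⟨rfl, hlast⟩
      rw [cast_centralBinom_three_mul_add_two_eq_ite, ih h12]
      simp only [hlast, ↓reduceIte, OfNat.ofNat_ne_one, add_zero, ne_eq,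
        not_false_eq_true, and_true]
      ring

theorem cast_centralBinom_trichotomy (n : ℕ) :
    (digitCount 2 n = 0 ∧ ¬ ContainsZeroTwo n ∧ ¬ ContainsOneTwo n ∧
      (n.centralBinom : ZMod 9) = (-1) ^ digitCount 1 n * 7 ^ oneStringCount n) ∨
    (digitCount 2 n = 1 ∧ ContainsZeroTwo n ∧ ¬ ContainsOneTwo n ∧
      (n.centralBinom : ZMod 9) = 6 * (-1) ^ digitCount 1 n) ∨
    (digitCount 2 n ≠ 0 ∧ (2 ≤ digitCount 2 n ∨ ContainsOneTwo n) ∧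
      ¬ (ContainsZeroTwo n ∧ digitCount 2 n = 1) ∧ (n.centralBinom : ZMod 9) = 0) := by
  by_cases h12 : ContainsOneTwo n
  · have hexcl : ¬ (ContainsZeroTwo n ∧ digitCount 2 n = 1) := fun ⟨h02, hone⟩ =>
      (containsZeroTwo_iff_not_containsOneTwo hone).mp h02 h12
    exact .inr <| .inr ⟨h12.digitCount_two_pos.ne', .inr h12, hexcl,
      cast_centralBinom_of_containsOneTwo h12⟩
  · have hc := cast_centralBinom_of_not_containsOneTwo h12
    obtain h2 | h2 | h2 : digitCount 2 n = 0 ∨ digitCount 2 n = 1 ∨ 2 ≤ digitCount 2 n := by omega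
    · have h02 : ¬ ContainsZeroTwo n := fun h => h.digitCount_two_pos.ne' h2
      exact .inl ⟨h2, h02, h12, by simpa [h2] using hc⟩
    · have h02 := (containsZeroTwo_iff_not_containsOneTwo h2).mpr h12
      rw [h2, pow_one, mul_assoc, mul_comm (7 ^ _), six_mul_seven_pow_zmod_nine, mul_comm] at hc
      exact .inr <| .inl ⟨h2, h02, h12, hc⟩
    · rw [six_pow_eq_zero_zmod_nine h2, mul_zero] at hc
      exact .inr <| .inr ⟨by omega, .inl h2, by omega, hc⟩

theorem cast_centralBinom_eq_neg_one_pow_mul_seven_pow_iff (n a b : ℕ) :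
    (n.centralBinom : ZMod 9) = (-1) ^ a * 7 ^ b ↔
      digitCount 2 n = 0 ∧ digitCount 1 n ≡ a [MOD 2] ∧ oneStringCount n ≡ b [MOD 3] := by
  obtain ⟨h2, -, -, hc⟩ | ⟨h2, -, -, hc⟩ | ⟨h2, -, -, hc⟩ := cast_centralBinom_trichotomy n <;>
    rw [hc]
  · rw [neg_one_pow_mul_seven_pow_inj_zmod_nine, and_iff_right h2]
  · exact iff_of_false (six_mul_ne_neg_one_pow_mul_seven_pow_zmod_nine _ a b) (by simp [h2])
  · exact iff_of_false (neg_one_pow_mul_seven_pow_ne_zero_zmod_nine a b).symm (by simp [h2])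

theorem cast_centralBinom_eq_six_mul_neg_one_pow_iff (n a : ℕ) :
    (n.centralBinom : ZMod 9) = 6 * (-1) ^ a ↔
      ContainsZeroTwo n ∧ digitCount 2 n = 1 ∧ digitCount 1 n ≡ a [MOD 2] := by
  obtain ⟨h2, -, -, hc⟩ | ⟨h2, h02, -, hc⟩ | ⟨-, -, hexcl, hc⟩ :=
    cast_centralBinom_trichotomy n <;> rw [hc]
  · exact iff_of_false (six_mul_ne_neg_one_pow_mul_seven_pow_zmod_nine _ _ _).symm (by simp [h2])
  · rw [six_mul_neg_one_pow_inj_zmod_nine, and_iff_right h02, and_iff_right h2]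
  · exact iff_of_false (six_mul_neg_one_pow_ne_zero_zmod_nine a).symm
      (fun h => hexcl ⟨h.1, h.2.1⟩)

theorem cast_centralBinom_eq_zero_iff (n : ℕ) :
    (n.centralBinom : ZMod 9) = 0 ↔ 2 ≤ digitCount 2 n ∨ ContainsOneTwo n := by
  obtain ⟨h2, -, h12, hc⟩ | ⟨h2, -, h12, hc⟩ | ⟨-, hzero, -, hc⟩ :=
    cast_centralBinom_trichotomy n <;> rw [hc]
  · exact iff_of_false (neg_one_pow_mul_seven_pow_ne_zero_zmod_nine _ _) (by simp [h2, h12])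
  · exact iff_of_false (six_mul_neg_one_pow_ne_zero_zmod_nine _) (by simp [h2, h12])
  · exact iff_of_true rfl hzero

theorem mainTheorem9 :
    (∀ r : ℕ, 0 < r → r ≡ 2 [MOD 6] → ∀ n : ℕ,
      (aperyNumber n r 0 ≡ 1 [MOD 9] ↔
        digitCount 2 n = 0 ∧ Even (digitCount 1 n) ∧ oneStringCount n ≡ 0 [MOD 3]) ∧
      (aperyNumber n r 0 ≡ 2 [MOD 9] ↔
        digitCount 2 n = 0 ∧ Odd (digitCount 1 n) ∧ oneStringCount n ≡ 1 [MOD 3]) ∧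
      (aperyNumber n r 0 ≡ 3 [MOD 9] ↔
        ContainsZeroTwo n ∧ digitCount 2 n = 1 ∧ Odd (digitCount 1 n)) ∧
      (aperyNumber n r 0 ≡ 4 [MOD 9] ↔
        digitCount 2 n = 0 ∧ Even (digitCount 1 n) ∧ oneStringCount n ≡ 2 [MOD 3]) ∧
      (aperyNumber n r 0 ≡ 5 [MOD 9] ↔
        digitCount 2 n = 0 ∧ Odd (digitCount 1 n) ∧ oneStringCount n ≡ 2 [MOD 3]) ∧
      (aperyNumber n r 0 ≡ 6 [MOD 9] ↔
        ContainsZeroTwo n ∧ digitCount 2 n = 1 ∧ Even (digitCount 1 n)) ∧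
      (aperyNumber n r 0 ≡ 7 [MOD 9] ↔
        digitCount 2 n = 0 ∧ Even (digitCount 1 n) ∧ oneStringCount n ≡ 1 [MOD 3]) ∧
      (aperyNumber n r 0 ≡ 8 [MOD 9] ↔
        digitCount 2 n = 0 ∧ Odd (digitCount 1 n) ∧ oneStringCount n ≡ 0 [MOD 3]) ∧
      (aperyNumber n r 0 ≡ 0 [MOD 9] ↔
        2 ≤ digitCount 2 n ∨ ContainsOneTwo n)) ∧
    (∀ n : ℕ, aperyNumber n 2 0 = (2 * n).choose n) := by
  refine ⟨fun r _ hr n => ?_, aperyNumber_two_zero⟩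
  have hunit := cast_centralBinom_eq_neg_one_pow_mul_seven_pow_iff n
  have hsix := cast_centralBinom_eq_six_mul_neg_one_pow_iff n
  simp only [← ZMod.natCast_eq_natCast_iff (c := 9), cast_aperyNumber_zmod_nine hr,
    Nat.even_iff, Nat.odd_iff]
  exact ⟨hunit 0 0, hunit 1 1, hsix 1, hunit 0 2, hunit 1 2, hsix 0, hunit 0 1, hunit 1 0,
    cast_centralBinom_eq_zero_iff n⟩
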